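/- Let $G=(V,E)$ be a finite or locally finite (simple, undirected, not necessarily connected) graph with weights $w_{xy}>0$ for $y\sim x$ (not necessarily symmetric) and a vertex measure $\mu:V\to(0,\infty)$. Put $\deg(x)=\sum_{y\sim x}w_{xy}$, $$\Delta f(x)=\frac1{\mu(x)}\sum_{y\sim x}w_{xy}(f(y)-f(x)),\qquad 2\Gamma(f,g)(x)=\frac1{\mu(x)}\sum_{y\sim x}w_{xy}(f(y)-f(x))(g(y)-g(x)),$$ $\Gamma(f)=\Gamma(f,f)$ and $2\Gamma_2(f)=\Delta\Gamma(f)-2\Gamma(f,\Delta f)$. For $n>0$ and $\kappa\in\mathbb R$, the graph satisfies $CDE(n,\kappa)$ if for every $x\in V$ and every $f:V\to(0,\infty)$ with $\Delta f(x)<0$, $$\Gamma_2(f)(x)-\Gamma\Big(f,\frac{\Gamma(f)}{f}\Big)(x)\ \ge\ \frac1n(\Delta f(x))^2+\kappa\,\Gamma(f)(x).$$ Assume that $D_\mu=\sup_{x\in V}\deg(x)/\mu(x)<\infty$ and $D_w=\sup_{x\in V,\,y\sim x}\deg(x)/w_{xy}<\infty$ (with $D_w=0$ if there are no edges), and that $G$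 satisfies $CDE(n,-K)$ for some real $n>0$, $K>0$. Let $x_0\in V$, $R>1$, and let $u(x,t)>0$ be defined for $x\in V$, $t>0$, such that $\partial_tu(x,t)=\Delta u(x,t)$ for all $t>0$ and all $x$ with graph distance $d(x_0,x)<2R$ (no equation is required elsewhere). Then for every $0<\alpha<1$, every $t>0$ and every $x$ with $d(x_0,x)\le R$, at $(x,t)$, $$\frac{(1-\alpha)\Gamma(\sqrt u)}{u}-\frac{\partial_t\sqrt u}{\sqrt u}\le\min\left\{D_\mu,\ \frac{n}{2(1-\alpha)t}+\frac{n(2+D_w)D_\mu}{(1-\alpha)R}+\frac{Kn}{2\alpha}\right\}.$$ -/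

import Mathlib

noncomputable section

namespace WGraph

variable {V : Type*} (G : SimpleGraph V) [G.LocallyFinite] (w : V → V → ℝ) (μ : V → ℝ)

/-- The weighted degree `deg(x) = ∑_{y ∼ x} w_{xy}`. -/
def deg (x : V) : ℝ := ∑ y ∈ G.neighborFinset x, w x y

/-- The `μ`-Laplacian `Δf(x) = (1/μ(x)) ∑_{y ∼ x} w_{xy} (f(y) - f(x))`. -/
def lap (f : V → ℝ) (x : V) : ℝ :=
  (1 / μ x) * ∑ y ∈ G.neighborFinset x, w x y * (f y - f x)

/-- The gradient form, `2Γ(f,g)(x) = (1/μ(x)) ∑_{y ∼ x} w_{xy} (f(y) - f(x)) (g(y) - g(x))`. -/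
def Gam (f g : V → ℝ) (x : V) : ℝ :=
  (1 / 2) * ((1 / μ x) * ∑ y ∈ G.neighborFinset x, w x y * ((f y - f x) * (g y - g x)))

/-- The iterated gradient form, `2Γ₂(f) = ΔΓ(f) - 2Γ(f, Δf)`. -/
def Gam2 (f : V → ℝ) (x : V) : ℝ :=
  (1 / 2) * lap G w μ (Gam G w μ f f) x - Gam G w μ f (lap G w μ f) x

/-- The modified iterated gradient form `Γ₂(f) - Γ(f, Γ(f)/f)`, for positive `f`. -/
def Gam2Tilde (f : V → ℝ) (x : V) : ℝ :=
  Gam2 G w μ f x - Gam G w μ f (fun y => Gam G w μ f f y / f y) x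

/-- The exponential curvature-dimension inequality `CDE(n, κ)`: at every vertex `x` and for every
positive function `f` on `V` with `Δf(x) < 0`,
`Γ₂(f)(x) - Γ(f, Γ(f)/f)(x) ≥ (1/n) (Δf(x))² + κ Γ(f)(x)`. -/
def CDE (n κ : ℝ) : Prop :=
  ∀ x : V, ∀ f : V → ℝ, (∀ y, 0 < f y) → lap G w μ f x < 0 →
    (1 / n) * (lap G w μ f x) ^ 2 + κ * Gam G w μ f f x ≤ Gam2Tilde G w μ f x

/-- The quotients `deg(x)/μ(x)`, `x ∈ V`. -/
def degMuRatios : Set ℝ := {r | ∃ x : V, r = deg G w x / μ x}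

/-- `D_μ = sup_x deg(x)/μ(x)`. -/
def Dmu : ℝ := sSup (degMuRatios G w μ)

/-- The quotients `deg(x)/w_{xy}`, `x ∈ V`, `y ∼ x`. -/
def degWRatios : Set ℝ := {r | ∃ x y : V, G.Adj x y ∧ r = deg G w x / w x y}

/-- `D_w = sup_{x, y ∼ x} deg(x)/w_{xy}`. -/
def Dw : ℝ := sSup (degWRatios G w)

end WGraph

namespace WGraph

/-- The vertices at graph distance less than `r` from `x₀` (in the component of `x₀`). -/
def openBall {V : Type*} (G : SimpleGraph V) (x₀ : V) (r : ℝ) : Set V :=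
  {x | G.Reachable x₀ x ∧ (G.dist x₀ x : ℝ) < r}

/-- The vertices at graph distance at most `r` from `x₀` (in the component of `x₀`). -/
def closedBall {V : Type*} (G : SimpleGraph V) (x₀ : V) (r : ℝ) : Set V :=
  {x | G.Reachable x₀ x ∧ (G.dist x₀ x : ℝ) ≤ r}

end WGraph

end

namespace WGraph

/-! With f = √u the heat equation reads ∂ₜf = Δf + Γ(f)/f, so the left side is H = -αΓ(f)/f² - Δf/f,
which positivity of f bounds by D_μ. The other bound is a maximum principle for tφH, with φ a
cut-off of slope 1/R.

Since f²H = (1-α)Γ(f) - ½Δ(f²), comparing the time derivative of this identity with its Laplacian at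
the maximum cancels ΔΔ(f²) and leaves 2(1-α)(Γ₂(f) - Γ(f, Γ(f)/f)), up to a cut-off error of order
D_w D_μ/R (`lap_sq_mul_le`). CDE bounds this below by 2(1-α)f²H²/n once H ≥ Kn/(2α), so H is bounded
at the maximum (`mul_liYau_le_of_max`).

The maximum must have its neighbours inside the ball where the equation holds. On the layer φ ≤ 2/R
one uses H ≤ D_μ instead, at cost 2D_μ/R. The stated bound absorbs this unless n(2+D_w) < 2(1-α);
for such small n, CDE itself forces D_μ ≤ Kn/(2α) (`two_mul_Dmu_le`). -/

theorem dist_le_dist_add_one {V : Type*} {G : SimpleGraph V} {x₀ x y : V} (hx : G.Reachable x₀ x) (h : G.Adj x y) :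
    G.dist x₀ y ≤ G.dist x₀ x + 1 := by
  obtain ⟨p, hp⟩ := hx.exists_walk_length_eq_dist
  have := SimpleGraph.dist_le (p.concat h)
  simpa [hp] using this

/-! ### Elementary calculus of Δ, Γ and the constants D_μ, D_w. -/

variable {V : Type*} {G : SimpleGraph V} [G.LocallyFinite] {w : V → V → ℝ} {μ : V → ℝ}

/-- For positive `f`, the quotient `-Δf/f` is at most `deg/μ`. -/
theorem neg_lap_div_le (hw : ∀ x y, G.Adj x y → 0 < w x y) (hμ : ∀ x, 0 < μ x)
    {f : V → ℝ} (hf : ∀ y, 0 < f y) (x : V) :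
    -lap G w μ f x / f x ≤ deg G w x / μ x := by
  have h : 0 ≤ ∑ y ∈ G.neighborFinset x, w x y * f y :=
    Finset.sum_nonneg fun y hy =>
      (mul_pos (hw x y ((G.mem_neighborFinset x y).1 hy)) (hf y)).le
  have e : lap G w μ f x
      = (1 / μ x) * ((∑ y ∈ G.neighborFinset x, w x y * f y) - deg G w x * f x) := by
    simp only [lap, deg, mul_sub, Finset.sum_sub_distrib, Finset.sum_mul]
  have hx := hf x
  have hm := hμ x
  rw [e, div_le_iff₀ hx]
  have : 0 ≤ (1 / μ x) * ∑ y ∈ G.neighborFinset x, w x y * f y := by positivity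
  have e2 : deg G w x / μ x * f x = (1 / μ x) * (deg G w x * f x) := by ring
  rw [e2]
  linarith

theorem Gam_self_nonneg (hw : ∀ x y, G.Adj x y → 0 < w x y) (hμ : ∀ x, 0 < μ x)
    (f : V → ℝ) (x : V) : 0 ≤ Gam G w μ f f x := by
  have h : 0 ≤ ∑ y ∈ G.neighborFinset x, w x y * ((f y - f x) * (f y - f x)) :=
    Finset.sum_nonneg fun y hy =>
      mul_nonneg (hw x y ((G.mem_neighborFinset x y).1 hy)).le (mul_self_nonneg _)
  have hm := hμ x
  unfold Gam
  positivity

theorem lap_sq (f : V → ℝ) (x : V) :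
    lap G w μ (fun y => f y ^ 2) x = 2 * f x * lap G w μ f x + 2 * Gam G w μ f f x := by
  simp only [lap, Gam, Finset.mul_sum, ← Finset.sum_add_distrib]
  exact Finset.sum_congr rfl fun y _ => by ring

theorem lap_mul_sub_mul (a b : ℝ) (g h : V → ℝ) (x : V) :
    lap G w μ (fun y => a * g y - b * h y) x = a * lap G w μ g x - b * lap G w μ h x := by
  simp only [lap, Finset.mul_sum, ← Finset.sum_sub_distrib]
  exact Finset.sum_congr rfl fun y _ => by ring

theorem deg_nonneg (hw : ∀ x y, G.Adj x y → 0 < w x y) (x : V) : 0 ≤ deg G w x :=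
  Finset.sum_nonneg fun y hy => (hw x y ((G.mem_neighborFinset x y).1 hy)).le

theorem weight_le_deg (hw : ∀ x y, G.Adj x y → 0 < w x y) {x y : V} (h : G.Adj x y) :
    w x y ≤ deg G w x :=
  Finset.single_le_sum (f := fun z => w x z)
    (fun z hz => (hw x z ((G.mem_neighborFinset x z).1 hz)).le) ((G.mem_neighborFinset x y).2 h)

theorem deg_div_le_Dmu (hD : BddAbove (degMuRatios G w μ)) (x : V) :
    deg G w x / μ x ≤ Dmu G w μ :=
  le_csSup hD ⟨x, rfl⟩

theorem deg_le_Dw_mul (hw : ∀ x y, G.Adj x y → 0 < w x y) (hD : BddAbove (degWRatios G w))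
    {x y : V} (h : G.Adj x y) : deg G w x ≤ Dw G w * w x y :=
  (div_le_iff₀ (hw x y h)).1 (le_csSup hD ⟨x, y, h, rfl⟩)

theorem Dw_nonneg (hw : ∀ x y, G.Adj x y → 0 < w x y) : 0 ≤ Dw G w :=
  Real.sSup_nonneg (by
    rintro r ⟨a, b, hab, rfl⟩
    exact div_nonneg (deg_nonneg hw a) (hw a b hab).le)

theorem one_le_Dw (hw : ∀ x y, G.Adj x y → 0 < w x y) (hD : BddAbove (degWRatios G w))
    {x y : V} (h : G.Adj x y) : 1 ≤ Dw G w := by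
  have h1 := weight_le_deg hw h
  have h2 := deg_le_Dw_mul hw hD h
  have h3 := hw x y h
  by_contra! h4
  nlinarith

/-! ### The modified Γ₂ and what CDE says about D_μ. -/

/-- `2(Γ₂(f) - Γ(f, Γ(f)/f)) = ΔΓ(f) - 2Γ(f, v)` when `v = Δf + Γ(f)/f` at `x` and around it. -/
theorem two_mul_Gam2Tilde {f v : V → ℝ} {x : V}
    (hx : v x = lap G w μ f x + Gam G w μ f f x / f x)
    (hv : ∀ y, G.Adj x y → v y = lap G w μ f y + Gam G w μ f f y / f y) :
    2 * Gam2Tilde G w μ f x = lap G w μ (Gam G w μ f f) x - 2 * Gam G w μ f v x := by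
  have e : Gam G w μ f v x
      = Gam G w μ f (lap G w μ f) x + Gam G w μ f (fun y => Gam G w μ f f y / f y) x := by
    rw [Gam, Gam, Gam, ← mul_add, ← mul_add, ← Finset.sum_add_distrib]
    congr 2
    refine Finset.sum_congr rfl fun y hy => ?_
    rw [hx, hv y ((G.mem_neighborFinset x y).1 hy)]
    ring
  rw [Gam2Tilde, Gam2, e]
  ring

/-- Testing the inequality on a function with a single peak bounds `D_μ` by `n` and `K`. -/
theorem two_mul_Dmu_le (hw : ∀ x y, G.Adj x y → 0 < w x y) (hμ : ∀ x, 0 < μ x)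
    (hD : BddAbove (degMuRatios G w μ)) {n K : ℝ} (hn : 0 < n) (hK : 0 < K)
    (hCDE : CDE G w μ n (-K)) (x₀ : V) :
    2 * Dmu G w μ ≤ n * (K + 9 / 4 * Dmu G w μ) := by
  classical
  have hM : ∀ x, deg G w x / μ x ≤ Dmu G w μ := deg_div_le_Dmu hD
  have hM0 : 0 ≤ Dmu G w μ := (div_nonneg (deg_nonneg hw x₀) (hμ x₀).le).trans (hM x₀)
  suffices h : ∀ x, deg G w x / μ x ≤ n * (K + 9 / 4 * Dmu G w μ) / 2 by
    have : Dmu G w μ ≤ n * (K + 9 / 4 * Dmu G w μ) / 2 :=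
      csSup_le ⟨_, x₀, rfl⟩ (by rintro r ⟨x, rfl⟩; exact h x)
    linarith
  intro x
  have hMx := hM x
  set M := Dmu G w μ with hMdef
  set D := deg G w x / μ x with hDdef
  rcases (div_nonneg (deg_nonneg hw x) (hμ x).le).eq_or_lt with h0 | h0
  · rw [hDdef, ← h0]; positivity
  change 0 < D at h0
  -- Off x this function is constant, so at a neighbour y both Δf and Γ(f) see only the edge back to
  -- x, and w_{yx}/μ(y) ≤ M. No information on the 2-ball is needed.
  set f : V → ℝ := fun y => if y = x then 1 else 1 / 2 with hf
  have fx : f x = 1 := by simp [hf]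
  have fne : ∀ y, y ≠ x → f y = 1 / 2 := fun y hy => by simp [hf, hy]
  have fpos : ∀ y, 0 < f y := fun y => by
    by_cases h : y = x
    · rw [h, fx]; norm_num
    · rw [fne y h]; norm_num
  have sumx : ∀ (c : ℝ), (1 / μ x) * ∑ y ∈ G.neighborFinset x, w x y * c = D * c := fun c => by
    rw [← Finset.sum_mul, hDdef, deg]; ring
  have lapx : lap G w μ f x = D * (-1 / 2) := by
    rw [← sumx, lap]
    congr 1
    refine Finset.sum_congr rfl fun y hy => ?_
    rw [fx, fne y ((G.mem_neighborFinset x y).1 hy).ne']; norm_num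
  have gamx : Gam G w μ f f x = D / 8 := by
    have : D / 8 = 1 / 2 * (D * (1 / 4)) := by ring
    rw [this, ← sumx, Gam]
    congr 2
    refine Finset.sum_congr rfl fun y hy => ?_
    rw [fx, fne y ((G.mem_neighborFinset x y).1 hy).ne']; norm_num
  have sumy : ∀ y, G.Adj x y → ∀ g : V → ℝ, (∀ z, z ≠ x → g z = 0) →
      ∑ z ∈ G.neighborFinset y, w y z * g z = w y x * g x := fun y hy g hg =>
    Finset.sum_eq_single x (fun z _ hz => by rw [hg z hz, mul_zero])
      (fun h => absurd ((G.mem_neighborFinset y x).2 hy.symm) h)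
  have lapy : ∀ y, G.Adj x y → lap G w μ f y = w y x / μ y / 2 := fun y hy => by
    rw [lap, sumy y hy (fun z => f z - f y)
      (fun z hz => by rw [fne z hz, fne y hy.ne', sub_self]), fx, fne y hy.ne']
    ring
  have gamy : ∀ y, G.Adj x y → Gam G w μ f f y = w y x / μ y / 8 := fun y hy => by
    rw [Gam, sumy y hy (fun z => (f z - f y) * (f z - f y))
      (fun z hz => by rw [fne z hz, fne y hy.ne', sub_self, mul_zero]), fx, fne y hy.ne']
    ring
  obtain ⟨v, hv⟩ : ∃ v : V → ℝ, ∀ y, v y = lap G w μ f y + Gam G w μ f f y / f y :=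
    ⟨_, fun _ => rfl⟩
  have key := two_mul_Gam2Tilde (hv x) (fun y _ => hv y)
  have gamv : Gam G w μ f v x = 1 / 2 * (1 / μ x *
    ∑ y ∈ G.neighborFinset x, w x y * ((f y - f x) * (v y - v x))) := rfl
  have up : 2 * Gam2Tilde G w μ f x ≤ D * (M / 2 + D / 16) := by
    rw [key, ← sumx, lap, gamv]
    have : ∀ a b c : ℝ, a * b - 2 * (1 / 2 * (a * c)) = a * (b - c) := fun a b c => by ring
    rw [this, ← Finset.sum_sub_distrib]
    refine mul_le_mul_of_nonneg_left (Finset.sum_le_sum fun y hy => ?_)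
      (by have := hμ x; positivity)
    have hy := (G.mem_neighborFinset x y).1 hy
    have hq : w y x / μ y ≤ M :=
      (div_le_div_of_nonneg_right (weight_le_deg hw hy.symm) (hμ y).le).trans (hM y)
    rw [← mul_sub, hv, hv, lapy y hy, gamy y hy, lapx, gamx, fx, fne y hy.ne']
    refine mul_le_mul_of_nonneg_left ?_ (hw x y hy).le
    linarith
  have lo := hCDE x f fpos (by rw [lapx]; linarith)
  rw [lapx, gamx] at lo
  have h1 : D * (D / (4 * n)) ≤ D * (K / 8 + M / 4 + D / 32) := by
    have : 1 / n * (D * (-1 / 2)) ^ 2 = D * (D / (4 * n)) := by field_simp; ring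
    linarith
  have h2 := le_of_mul_le_mul_left h1 h0
  rw [div_le_iff₀ (by positivity)] at h2
  have h3 : n * D ≤ n * M := mul_le_mul_of_nonneg_left hMx hn.le
  nlinarith

/-! ### The Li-Yau quantity and the spatial maximum principle. -/

/-- The quantity `-α Γ(f)/f² - Δf/f`. -/
noncomputable def liYau (G : SimpleGraph V) [G.LocallyFinite] (w : V → V → ℝ) (μ : V → ℝ) (α : ℝ)
    (f : V → ℝ) (x : V) : ℝ :=
  -(α * Gam G w μ f f x / f x ^ 2) - lap G w μ f x / f x

theorem liYau_le_Dmu (hw : ∀ x y, G.Adj x y → 0 < w x y) (hμ : ∀ x, 0 < μ x)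
    (hD : BddAbove (degMuRatios G w μ)) {α : ℝ} (hα : 0 < α) {f : V → ℝ} (hf : ∀ y, 0 < f y)
    (x : V) : liYau G w μ α f x ≤ Dmu G w μ := by
  have h1 := (neg_lap_div_le hw hμ hf x).trans (deg_div_le_Dmu hD x)
  have h2 : 0 ≤ α * Gam G w μ f f x / f x ^ 2 := by
    have := Gam_self_nonneg hw hμ f x
    positivity
  rw [neg_div] at h1
  rw [liYau]
  linarith

/-- Multiplying by f² clears the denominators: the result is linear in Γ(f) and Δ(f²), so Δ and ∂ₜ
can be applied term by term. -/
theorem sq_mul_liYau {α : ℝ} {f : V → ℝ} (hf : ∀ y, 0 < f y) (x : V) :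
    f x ^ 2 * liYau G w μ α f x
      = (1 - α) * Gam G w μ f f x - 1 / 2 * lap G w μ (fun y => f y ^ 2) x := by
  have := (hf x).ne'
  rw [liYau, lap_sq]
  field_simp
  ring

/-- The spatial part of the maximum principle: at a maximum of `φ H` with `H > 0`,
the Laplacian of `f² H` is controlled by `H Δ(f²)`. -/
theorem lap_sq_mul_le (hw : ∀ x y, G.Adj x y → 0 < w x y) (hμ : ∀ x, 0 < μ x)
    (hDμ : BddAbove (degMuRatios G w μ)) (hDw : BddAbove (degWRatios G w))
    {f : V → ℝ} (hf : ∀ y, 0 < f y) {x : V} (hlap : lap G w μ f x ≤ 0)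
    {φ H : V → ℝ} {δ : ℝ} (hδ : 0 < δ) (hφx : 2 * δ ≤ φ x)
    (hφ : ∀ y, G.Adj x y → φ x - δ ≤ φ y) (hHx : 0 ≤ H x)
    (hmax : ∀ y, G.Adj x y → φ y * H y ≤ φ x * H x) :
    lap G w μ (fun y => f y ^ 2 * H y) x ≤ H x * lap G w μ (fun y => f y ^ 2) x
      + H x * f x ^ 2 * (2 * δ * Dw G w * Dmu G w μ) / φ x := by
  have hm := hμ x
  have hφ0 : 0 < φ x := by linarith
  have hfx := hf x
  have hsum : ∑ y ∈ G.neighborFinset x, w x y * f y ≤ deg G w x * f x := by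
    have e : lap G w μ f x
        = (1 / μ x) * ((∑ y ∈ G.neighborFinset x, w x y * f y) - deg G w x * f x) := by
      simp only [lap, deg, mul_sub, Finset.sum_sub_distrib, Finset.sum_mul]
    rw [e] at hlap
    have := nonpos_of_mul_nonpos_right hlap (by positivity)
    linarith
  have hterm : ∀ y ∈ G.neighborFinset x, w x y * f y ≤ deg G w x * f x := fun y hy =>
    (Finset.single_le_sum (f := fun z => w x z * f z)
      (fun z hz => (mul_pos (hw x z ((G.mem_neighborFinset x z).1 hz)) (hf z)).le) hy).trans hsum
  -- In the error ∑ w f(y)², one factor f(y) is bounded pointwise by D_w f(x) and the other is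
  -- summed using Δf(x) ≤ 0. This keeps D_w to the first power.
  have hfy : ∀ y ∈ G.neighborFinset x, f y ≤ Dw G w * f x := fun y hy => by
    have hy' := (G.mem_neighborFinset x y).1 hy
    have h1 := hterm y hy
    have h2 := mul_le_mul_of_nonneg_right (deg_le_Dw_mul hw hDw hy') hfx.le
    have : w x y * f y ≤ w x y * (Dw G w * f x) := by linarith
    exact le_of_mul_le_mul_left this (hw x y hy')
  -- Maximality gives H(y) ≤ H(x)φ(x)/φ(y), and φ(y) ≥ φ(x) - δ ≥ φ(x)/2 turns this into H(y) ≤ H(x)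
  -- + c.
  set c := H x * (2 * δ / φ x) with hc
  have hc0 : 0 ≤ c := by positivity
  have hpt : ∀ y ∈ G.neighborFinset x,
      w x y * (f y ^ 2 * H y - f x ^ 2 * H x)
        ≤ H x * (w x y * (f y ^ 2 - f x ^ 2)) + c * (Dw G w * f x) * (w x y * f y) := by
    intro y hy
    have hy' := (G.mem_neighborFinset x y).1 hy
    have hwy := hw x y hy'
    have hφy : 0 < φ y := by linarith [hφ y hy']
    have h1 : H y ≤ H x + c := by
      have h2 : H x * φ x ≤ (H x + c) * φ y := by
        have a1 := hφ y hy'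
        have a2 : φ x / 2 ≤ φ y := by linarith
        have a3 : c * (φ x / 2) ≤ c * φ y := mul_le_mul_of_nonneg_left a2 hc0
        have a4 : c * (φ x / 2) = H x * δ := by rw [hc]; field_simp
        have a5 : H x * (φ x - δ) ≤ H x * φ y := mul_le_mul_of_nonneg_left a1 hHx
        nlinarith
      have h3 := hmax y hy'
      by_contra! h4
      nlinarith [mul_lt_mul_of_pos_right h4 hφy]
    have h5 : f y ^ 2 * H y ≤ f y ^ 2 * H x + c * (Dw G w * f x) * f y := by
      have b1 := mul_le_mul_of_nonneg_left h1 (sq_nonneg (f y))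
      have b2 : c * f y * f y ≤ c * f y * (Dw G w * f x) :=
        mul_le_mul_of_nonneg_left (hfy y hy) (mul_nonneg hc0 (hf y).le)
      nlinarith
    have h6 := mul_le_mul_of_nonneg_left h5 hwy.le
    nlinarith
  have hDw0 := Dw_nonneg hw
  have htot := mul_le_mul_of_nonneg_left (Finset.sum_le_sum hpt) (by positivity : 0 ≤ 1 / μ x)
  rw [Finset.sum_add_distrib, ← Finset.mul_sum, ← Finset.mul_sum] at htot
  have h7 : (1 / μ x) * (∑ y ∈ G.neighborFinset x, w x y * f y) ≤ Dmu G w μ * f x := by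
    calc (1 / μ x) * (∑ y ∈ G.neighborFinset x, w x y * f y)
        ≤ (1 / μ x) * (deg G w x * f x) := mul_le_mul_of_nonneg_left hsum (by positivity)
      _ = deg G w x / μ x * f x := by ring
      _ ≤ _ := mul_le_mul_of_nonneg_right (deg_div_le_Dmu hDμ x) hfx.le
  have h8 := mul_le_mul_of_nonneg_left h7 (by positivity : 0 ≤ c * (Dw G w * f x))
  have e9 : H x * f x ^ 2 * (2 * δ * Dw G w * Dmu G w μ) / φ x
      = c * (Dw G w * f x) * (Dmu G w μ * f x) := by rw [hc]; ring
  rw [e9, lap, lap]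
  nlinarith

/-! ### Time derivatives, and finiteness of balls. -/

/-- If `h` attains a maximum over the interval to the left of `t`, then `h'(t) ≥ 0`. -/
theorem nonneg_of_hasDerivAt_of_left_max {h : ℝ → ℝ} {h' t : ℝ} (ht : 0 < t)
    (hd : HasDerivAt h h' t) (hmax : ∀ s, 0 < s → s ≤ t → h s ≤ h t) : 0 ≤ h' := by
  have h1 := (hasDerivAt_iff_tendsto_slope.1 hd).mono_left
    (nhdsWithin_mono t (fun s (hs : s < t) => ne_of_lt hs) :
      nhdsWithin t (Set.Iio t) ≤ nhdsWithin t {t}ᶜ)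
  refine ge_of_tendsto h1 ?_
  filter_upwards [Ioo_mem_nhdsLT ht] with s hs
  rw [slope_def_field]
  exact div_nonneg_of_nonpos (by linarith [hmax s hs.1 hs.2.le]) (by linarith [hs.2])

theorem hasDerivAt_lap {g : ℝ → V → ℝ} {g' : V → ℝ} {x : V} {t : ℝ}
    (hx : HasDerivAt (fun s => g s x) (g' x) t)
    (hg : ∀ y, G.Adj x y → HasDerivAt (fun s => g s y) (g' y) t) :
    HasDerivAt (fun s => lap G w μ (g s) x) (lap G w μ g' x) t :=
  (HasDerivAt.fun_sum fun y hy =>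
    ((hg y ((G.mem_neighborFinset x y).1 hy)).sub hx).const_mul (w x y)).const_mul _

theorem hasDerivAt_Gam_self {g : ℝ → V → ℝ} {g' : V → ℝ} {x : V} {t : ℝ}
    (hx : HasDerivAt (fun s => g s x) (g' x) t)
    (hg : ∀ y, G.Adj x y → HasDerivAt (fun s => g s y) (g' y) t) :
    HasDerivAt (fun s => Gam G w μ (g s) (g s) x) (2 * Gam G w μ (g t) g' x) t := by
  have h := ((HasDerivAt.fun_sum (u := G.neighborFinset x) fun y hy =>
    ((((hg y ((G.mem_neighborFinset x y).1 hy)).sub hx).mul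
      ((hg y ((G.mem_neighborFinset x y).1 hy)).sub hx)).const_mul
        (w x y))).const_mul (1 / μ x)).const_mul (1 / 2 : ℝ)
  refine h.congr_deriv ?_
  simp only [Gam, Finset.mul_sum]
  exact Finset.sum_congr rfl fun y _ => by simp only [Pi.sub_apply]; ring

theorem finite_openBall (x₀ : V) (r : ℝ) : (openBall G x₀ r).Finite := by
  have key : ∀ m : ℕ, {x | G.Reachable x₀ x ∧ G.dist x₀ x ≤ m}.Finite := by
    intro m
    induction m with
    | zero =>
      refine (Set.finite_singleton x₀).subset ?_
      rintro x ⟨h, hd⟩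
      exact (h.dist_eq_zero_iff.1 (Nat.le_zero.1 hd)).symm
    | succ m ih =>
      refine ((ih.biUnion fun y _ => (G.neighborSet y).toFinite).union ih).subset ?_
      rintro x ⟨h, hd⟩
      obtain ⟨p, hp⟩ := h.exists_walk_length_eq_dist
      rcases Nat.lt_or_ge (G.dist x₀ x) (m + 1) with h1 | h1
      · exact Or.inr ⟨h, by omega⟩
      · left
        have hnn : ¬ p.Nil := by
          intro hnil
          have := SimpleGraph.Walk.length_eq_zero_iff.2 hnil
          omega
        have hadj := p.adj_penultimate hnn
        simp only [Set.mem_iUnion]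
        refine ⟨p.penultimate, ⟨⟨p.dropLast⟩, ?_⟩, hadj⟩
        have h2 := SimpleGraph.dist_le p.dropLast
        have h3 : p.dropLast.length = p.length - 1 := by
          simp [SimpleGraph.Walk.dropLast]
        omega
  refine (key ⌈r⌉₊).subset ?_
  rintro x ⟨h, hd⟩
  exact ⟨h, by exact_mod_cast hd.le.trans (Nat.le_ceil r)⟩

/-! ### The differential inequality at a maximum. -/

/-- The curvature inequality at a space-time maximum of `t φ H`, where `H` is the Li-Yau quantity
of the square root `f` of a solution of the heat equation. -/
theorem mul_liYau_le_of_max (hw : ∀ x y, G.Adj x y → 0 < w x y) (hμ : ∀ x, 0 < μ x)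
    (hDμ : BddAbove (degMuRatios G w μ)) (hDw : BddAbove (degWRatios G w))
    {n K : ℝ} (hn : 0 < n) (hCDE : CDE G w μ n (-K)) {α : ℝ} (hα₀ : 0 < α) (hα₁ : α < 1)
    {f : ℝ → V → ℝ} {t : ℝ} (ht : 0 < t) (hf : ∀ s y, 0 < s → 0 < f s y) {x : V}
    (hx : HasDerivAt (fun s => f s x) (lap G w μ (f t) x + Gam G w μ (f t) (f t) x / f t x) t)
    (hnb : ∀ y, G.Adj x y →
      HasDerivAt (fun s => f s y) (lap G w μ (f t) y + Gam G w μ (f t) (f t) y / f t y) t)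
    (htime : ∀ s, 0 < s → s ≤ t → s * liYau G w μ α (f s) x ≤ t * liYau G w μ α (f t) x)
    {φ : V → ℝ} {δ : ℝ} (hδ : 0 < δ) (hφx : 2 * δ ≤ φ x)
    (hφ : ∀ y, G.Adj x y → φ x - δ ≤ φ y)
    (hspace : ∀ y, G.Adj x y → φ y * liYau G w μ α (f t) y ≤ φ x * liYau G w μ α (f t) x)
    (hH : 0 < liYau G w μ α (f t) x) (hHK : K * n / (2 * α) ≤ liYau G w μ α (f t) x) :
    t * (φ x * liYau G w μ α (f t) x)
      ≤ n / (2 * (1 - α)) * (φ x + t * (2 * δ * Dw G w * Dmu G w μ)) := by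
  obtain ⟨v, hv⟩ : ∃ v : V → ℝ,
      ∀ y, v y = lap G w μ (f t) y + Gam G w μ (f t) (f t) y / f t y := ⟨_, fun _ => rfl⟩
  simp only [← hv] at hx hnb
  have hft : ∀ y, 0 < f t y := fun y => hf t y ht
  have hfx := hft x
  have hφ0 : 0 < φ x := by linarith
  have hΓ := Gam_self_nonneg hw hμ (f t) x
  set H := liYau G w μ α (f t) x with hHdef
  have hsplit : -lap G w μ (f t) x / f t x = H + α * (Gam G w μ (f t) (f t) x / f t x ^ 2) := by
    rw [hHdef, liYau]; ring
  set a := Gam G w μ (f t) (f t) x / f t x ^ 2 with ha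
  have ha0 : 0 ≤ a := by positivity
  have hlapx : lap G w μ (f t) x = -(f t x * (H + α * a)) := by
    rw [← hsplit]; field_simp
  have hΓx : Gam G w μ (f t) (f t) x = f t x ^ 2 * a := by rw [ha]; field_simp
  have hlapneg : lap G w μ (f t) x < 0 := by
    rw [hlapx]
    have : 0 < f t x * (H + α * a) := by positivity
    linarith
  have hcurv := hCDE x (f t) hft hlapneg
  have hG2 := two_mul_Gam2Tilde (hv x) (fun y _ => hv y)
  have hv2 : ∀ y, 2 * f t y * v y = lap G w μ (fun z => f t z ^ 2) y := fun y => by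
    rw [lap_sq, hv]
    have := (hft y).ne'
    field_simp
  have hsq : ∀ y, HasDerivAt (fun s => f s y) (v y) t →
      HasDerivAt (fun s => f s y ^ 2) (lap G w μ (fun z => f t z ^ 2) y) t := fun y h =>
    (h.fun_pow 2).congr_deriv (by rw [← hv2]; simp)
  set q : V → ℝ := fun y => f t y ^ 2 with hq
  have hdΓ := hasDerivAt_Gam_self (w := w) (μ := μ) (g := f) hx hnb
  have hdlap : HasDerivAt (fun s => lap G w μ (fun z => f s z ^ 2) x)
      (lap G w μ (lap G w μ q) x) t :=
    hasDerivAt_lap (g := fun s z => f s z ^ 2) (hsq x hx) (fun y hy => hsq y (hnb y hy))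
  have hQ := (hdΓ.const_mul (1 - α)).sub (hdlap.const_mul (1 / 2))
  set Q' := (1 - α) * (2 * Gam G w μ (f t) v x) - 1 / 2 * lap G w μ (lap G w μ q) x with hQ'
  -- tH is differentiated as tQ/f² with Q = (1-α)Γ(f) - ½Δ(f²), whose derivative involves ∂ₜf only
  -- at x and its neighbours.
  have hdiv := ((hasDerivAt_id t).mul hQ).div (hsq x hx) (by positivity)
  have hval : ∀ s, 0 < s → s * ((1 - α) * Gam G w μ (f s) (f s) x
      - 1 / 2 * lap G w μ (fun z => f s z ^ 2) x) / f s x ^ 2 = s * liYau G w μ α (f s) x := by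
    intro s hs
    have := hf s x hs
    rw [← sq_mul_liYau (fun y => hf s y hs) x]
    field_simp
  have hnn := nonneg_of_hasDerivAt_of_left_max ht hdiv (fun s hs hst => by
    have := htime s hs hst
    rw [hHdef, ← hval s hs, ← hval t ht] at this
    exact this)
  have hQt : (1 - α) * Gam G w μ (f t) (f t) x - 1 / 2 * lap G w μ q x = f t x ^ 2 * H :=
    (sq_mul_liYau hft x).symm
  have htimeQ : t * (H * lap G w μ q x) ≤ f t x ^ 2 * H + t * Q' := by
    rw [le_div_iff₀ (by positivity)] at hnn
    simp only [id, Pi.mul_apply, Pi.sub_apply, one_mul, zero_mul] at hnn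
    change 0 ≤ (((1 - α) * Gam G w μ (f t) (f t) x - 1 / 2 * lap G w μ q x) + t * Q') * f t x ^ 2
      - t * ((1 - α) * Gam G w μ (f t) (f t) x - 1 / 2 * lap G w μ q x) * lap G w μ q x at hnn
    rw [hQt] at hnn
    have : 0 ≤ f t x ^ 2 * (f t x ^ 2 * H + t * Q' - t * (H * lap G w μ q x)) := by linarith
    have := nonneg_of_mul_nonneg_right this (by positivity)
    linarith
  have hsp := lap_sq_mul_le hw hμ hDμ hDw hft hlapneg.le hδ hφx hφ hH.le hspace
  have hlapQ : lap G w μ (fun y => f t y ^ 2 * liYau G w μ α (f t) y) x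
      = (1 - α) * lap G w μ (Gam G w μ (f t) (f t)) x - 1 / 2 * lap G w μ (lap G w μ q) x := by
    simp only [sq_mul_liYau hft]
    exact lap_mul_sub_mul _ _ _ _ x
  rw [hlapQ] at hsp
  set C := 2 * δ * Dw G w * Dmu G w μ with hC
  have hα : 0 < 1 - α := by linarith
  have hup : t * (2 * (1 - α) * Gam2Tilde G w μ (f t) x)
      ≤ f t x ^ 2 * (H * (1 + t * (C / φ x))) := by
    have h1 : t * ((1 - α) * lap G w μ (Gam G w μ (f t) (f t)) x
        - 1 / 2 * lap G w μ (lap G w μ q) x)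
        ≤ t * (H * lap G w μ q x + H * f t x ^ 2 * C / φ x) :=
      mul_le_mul_of_nonneg_left hsp ht.le
    -- The terms ½ΔΔ(f²) from space and time cancel here.
    have h2 : 2 * (1 - α) * Gam2Tilde G w μ (f t) x = ((1 - α) *
        lap G w μ (Gam G w μ (f t) (f t)) x - 1 / 2 * lap G w μ (lap G w μ q) x) - Q' := by
      have : 2 * (1 - α) * Gam2Tilde G w μ (f t) x
        = (1 - α) * (2 * Gam2Tilde G w μ (f t) x) := by ring
      rw [this, hG2, hQ']; ring
    rw [h2]
    have h3 : t * (H * f t x ^ 2 * C / φ x) = f t x ^ 2 * (H * (t * (C / φ x))) := by ring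
    linarith
  have hlow : f t x ^ 2 * (H ^ 2 / n) ≤ Gam2Tilde G w μ (f t) x := by
    refine le_trans ?_ hcurv
    rw [hlapx, hΓx]
    have e : 1 / n * (-(f t x * (H + α * a))) ^ 2 + -K * (f t x ^ 2 * a)
        = f t x ^ 2 * (H ^ 2 / n + a * (2 * α * H / n - K) + α ^ 2 * a ^ 2 / n) := by ring
    rw [e]
    refine mul_le_mul_of_nonneg_left ?_ (by positivity)
    -- With -Δf/f = H + αa and a = Γ(f)/f², the cross term 2αHa/n of the square absorbs the
    -- curvature loss Ka.
    have h1 : K ≤ 2 * α * H / n := by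
      rw [div_le_iff₀ (by positivity)] at hHK
      rw [le_div_iff₀ hn]
      linarith
    have h2 : 0 ≤ a * (2 * α * H / n - K) := mul_nonneg ha0 (by linarith)
    have h3 : 0 ≤ α ^ 2 * a ^ 2 / n := by positivity
    linarith
  have hfin : (f t x ^ 2 * H) * (t * (2 * (1 - α) * (H / n)))
      ≤ (f t x ^ 2 * H) * (1 + t * (C / φ x)) := by
    have := mul_le_mul_of_nonneg_left hlow (by positivity : 0 ≤ t * (2 * (1 - α)))
    calc _ = t * (2 * (1 - α)) * (f t x ^ 2 * (H ^ 2 / n)) := by ring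
      _ ≤ _ := by linarith
  have hfin2 := le_of_mul_le_mul_left hfin (by positivity)
  have hfin3 := mul_le_mul_of_nonneg_left hfin2
    (by positivity : 0 ≤ n / (2 * (1 - α)) * φ x)
  have e1 : n / (2 * (1 - α)) * φ x * (t * (2 * (1 - α) * (H / n))) = t * (φ x * H) := by
    field_simp
  have e2 : n / (2 * (1 - α)) * φ x * (1 + t * (C / φ x))
      = n / (2 * (1 - α)) * (φ x + t * C) := by
    field_simp
  rwa [e1, e2] at hfin3

/-! ### Localization by a cut-off. -/

/-- The localized estimate from the maximum principle, for any `B` that dominates the contributions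
of the boundary layer of the cut-off, of the curvature, and of the interior maximum. -/
theorem liYau_le_of_heat (hw : ∀ x y, G.Adj x y → 0 < w x y) (hμ : ∀ x, 0 < μ x)
    (hDμ : BddAbove (degMuRatios G w μ)) (hDw : BddAbove (degWRatios G w))
    {n K : ℝ} (hn : 0 < n) (hK : 0 < K) (hCDE : CDE G w μ n (-K)) {α : ℝ} (hα₀ : 0 < α)
    (hα₁ : α < 1) {x₀ : V} {R : ℝ} (hR : 1 < R)
    {f : ℝ → V → ℝ} (hf : ∀ s y, 0 < s → 0 < f s y)
    (hheat : ∀ x ∈ openBall G x₀ (2 * R), ∀ t, 0 < t → HasDerivAt (fun s => f s x)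
      (lap G w μ (f t) x + Gam G w μ (f t) (f t) x / f t x) t)
    {T : ℝ} (hT : 0 < T) {B : ℝ} (hB₁ : 2 * Dmu G w μ / R ≤ B) (hB₂ : K * n / (2 * α) ≤ B)
    (hB₃ : n / ((1 - α) * (2 * T)) + n * Dw G w * Dmu G w μ / ((1 - α) * R) ≤ B)
    {x : V} (hx : x ∈ closedBall G x₀ R) : liYau G w μ α (f T) x ≤ B := by
  by_contra! hlt
  have hR0 : 0 < R := by linarith
  have hα : 0 < 1 - α := by linarith
  set M := Dmu G w μ with hM
  set H : ℝ → V → ℝ := fun t y => liYau G w μ α (f t) y with hH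
  have hHM : ∀ t y, 0 < t → H t y ≤ M := fun t y ht =>
    liYau_le_Dmu hw hμ hDμ hα₀ (fun z => hf t z ht) y
  have hB0 : 0 < B := lt_of_lt_of_le (by positivity) hB₂
  change B < H T x at hlt
  have hM0 : 0 < M := hB0.trans (hlt.trans_le (hHM T x hT))
  -- Unreachable vertices have `dist` 0, hence φ = 1; reachability is therefore carried separately
  -- below.
  set φ : V → ℝ := fun y => min 1 ((2 * R - G.dist x₀ y) / R) with hφ
  have hφ1 : ∀ y, φ y ≤ 1 := fun y => min_le_left _ _
  have hφx : φ x = 1 := by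
    refine min_eq_left ?_
    rw [le_div_iff₀ hR0]
    linarith [hx.2]
  have hbdry : ∀ t y, 0 < t → t ≤ T → φ y ≤ 2 / R → 0 ≤ φ y → t * (φ y * H t y) < T * H T x := by
    intro t y ht htT hy hy0
    have h1 : φ y * H t y ≤ 2 / R * M :=
      (mul_le_mul_of_nonneg_left (hHM t y ht) hy0).trans (mul_le_mul_of_nonneg_right hy hM0.le)
    have h2 : 2 / R * M = 2 * M / R := by ring
    calc t * (φ y * H t y) ≤ t * (2 * M / R) := mul_le_mul_of_nonneg_left (h2 ▸ h1) ht.le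
      _ ≤ T * (2 * M / R) := mul_le_mul_of_nonneg_right htT (by positivity)
      _ < T * H T x := mul_lt_mul_of_pos_left (by linarith) hT
  have hmem : ∀ y, G.Reachable x₀ y → 2 / R < φ y → y ∈ openBall G x₀ (2 * R - 2) := by
    intro y hy h
    have h1 := h.trans_le (min_le_right _ _)
    rw [div_lt_div_iff_of_pos_right hR0] at h1
    exact ⟨hy, by linarith⟩
  set S := openBall G x₀ (2 * R) with hS
  -- Shrinking the radius by 2 leaves room for one edge: neighbours of `S₂` still satisfy the heat
  -- equation and have φ ≥ 0.
  set S₂ := openBall G x₀ (2 * R - 2) with hS₂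
  have hS₂S : S₂ ⊆ S := fun y hy => ⟨hy.1, by linarith [hy.2]⟩
  have hnbr : ∀ y ∈ S₂, ∀ z, G.Adj y z → z ∈ S ∧ 0 ≤ φ z := by
    intro y hy z hz
    have h1 : (G.dist x₀ z : ℝ) ≤ G.dist x₀ y + 1 := by
      exact_mod_cast dist_le_dist_add_one hy.1 hz
    have h2 := hy.2
    refine ⟨⟨hy.1.trans hz.reachable, by linarith⟩, le_min zero_le_one ?_⟩
    exact div_nonneg (by linarith) hR0.le
  -- If R ≤ 2, the value φ(x) = 1 already lies in the boundary layer, and the layer estimate at (T,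
  -- x) contradicts itself.
  have hxS₂ : x ∈ S₂ := by
    refine hmem x hx.1 ?_
    by_contra! h
    have := hbdry T x hT le_rfl h (by rw [hφx]; exact zero_le_one)
    rw [hφx, one_mul] at this
    exact lt_irrefl _ this
  have hcont : ∀ y ∈ S₂, ∀ t, 0 < t → ContinuousAt (fun s => H s y) t := by
    intro y hy t ht
    have h1 := hheat y (hS₂S hy) t ht
    have h2 := fun z (hz : G.Adj y z) => hheat z (hnbr y hy z hz).1 t ht
    have hl := (hasDerivAt_lap (w := w) (μ := μ) (g := f)
      (g' := fun z => lap G w μ (f t) z + Gam G w μ (f t) (f t) z / f t z) h1 h2).continuousAt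
    have hg := (hasDerivAt_Gam_self (w := w) (μ := μ) (g := f)
      (g' := fun z => lap G w μ (f t) z + Gam G w μ (f t) (f t) z / f t z) h1 h2).continuousAt
    have hfy := (hf t y ht).ne'
    exact (((hg.const_mul α).div (h1.continuousAt.pow 2) (pow_ne_zero 2 hfy)).neg).sub
      (hl.div h1.continuousAt hfy)
  -- Nothing is assumed at time 0. Since H ≤ M, times up to τ give tφH at most half of T·H(T, x), so
  -- the search is over the compact interval [τ, T].
  set τ := T * H T x / (2 * M) with hτ
  have hHx0 : 0 < H T x := hB0.trans hlt
  have hτ0 : 0 < τ := by positivity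
  have hτT : τ ≤ T := by
    rw [hτ, div_le_iff₀ (by positivity)]
    nlinarith [hHM T x hT]
  have hsmall : ∀ t y, 0 < t → t ≤ τ → 0 ≤ φ y → t * (φ y * H t y) < T * H T x := by
    intro t y ht htτ hy
    have h1 : φ y * H t y ≤ M := by
      have a1 := mul_le_mul_of_nonneg_left (hHM t y ht) hy
      have a2 := mul_le_mul_of_nonneg_right (hφ1 y) hM0.le
      linarith
    have h2 : τ * M = T * H T x / 2 := by rw [hτ]; field_simp
    have h3 : 0 < T * H T x := by positivity
    calc t * (φ y * H t y) ≤ t * M := mul_le_mul_of_nonneg_left h1 ht.le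
      _ ≤ τ * M := mul_le_mul_of_nonneg_right htτ hM0.le
      _ < T * H T x := by linarith
  have hmaxt : ∀ y ∈ S₂, ∃ t ∈ Set.Icc τ T, ∀ s ∈ Set.Icc τ T,
      s * (φ y * H s y) ≤ t * (φ y * H t y) := by
    intro y hy
    have hc : ContinuousOn (fun s => s * (φ y * H s y)) (Set.Icc τ T) := fun s hs =>
      (continuousAt_id.mul ((hcont y hy s (hτ0.trans_le hs.1)).const_mul
        (φ y))).continuousWithinAt
    obtain ⟨t, ht, h⟩ := isCompact_Icc.exists_isMaxOn ⟨T, hτT, le_rfl⟩ hc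
    exact ⟨t, ht, fun s hs => h hs⟩
  choose! t ht htmax using hmaxt
  obtain ⟨y, hy, hymax⟩ := Set.exists_max_image S₂ (fun y => t y * (φ y * H (t y) y))
    (finite_openBall x₀ _) ⟨x, hxS₂⟩
  have hglob : ∀ z ∈ S₂, ∀ s ∈ Set.Icc τ T, s * (φ z * H s z) ≤ t y * (φ y * H (t y) y) :=
    fun z hz s hs => (htmax z hz s hs).trans (hymax z hz)
  have hge : T * H T x ≤ t y * (φ y * H (t y) y) := by
    have := hglob x hxS₂ T ⟨hτT, le_rfl⟩
    rwa [hφx, one_mul] at this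
  obtain ⟨htτ, htT⟩ := ht y hy
  set t' := t y with ht'
  have ht0 : 0 < t' := hτ0.trans_le htτ
  have hφy0 : 0 ≤ φ y := le_min zero_le_one (div_nonneg (by linarith [hy.2]) hR0.le)
  have hφy : 2 / R < φ y := by
    by_contra! h
    exact absurd (hbdry t' y ht0 htT h hφy0) (not_lt.2 hge)
  have hφypos : 0 < φ y := lt_of_le_of_lt (by positivity) hφy
  have hFpos : 0 < t' * (φ y * H t' y) := lt_of_lt_of_le (by positivity) hge
  have hHy : 0 < H t' y :=
    pos_of_mul_pos_right (pos_of_mul_pos_right hFpos ht0.le) hφy0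
  have hle : t' * (φ y * H t' y) ≤ T * H t' y := by
    have a1 : φ y * H t' y ≤ H t' y := by
      have := mul_le_mul_of_nonneg_right (hφ1 y) hHy.le
      linarith
    exact (mul_le_mul_of_nonneg_left a1 ht0.le).trans (mul_le_mul_of_nonneg_right htT hHy.le)
  have hBy : B ≤ H t' y := by
    have : T * H T x ≤ T * H t' y := hge.trans hle
    linarith [le_of_mul_le_mul_left this hT]
  have hfinal := mul_liYau_le_of_max hw hμ hDμ hDw hn hCDE hα₀ hα₁ ht0 hf (x := y) (φ := φ)
    (δ := 1 / R) (hheat y (hS₂S hy) t' ht0) (fun z hz => hheat z (hnbr y hy z hz).1 t' ht0)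
    (fun s hs hst => by
      have h1 : s * (φ y * H s y) ≤ t' * (φ y * H t' y) := by
        rcases le_total s τ with h | h
        · exact (hsmall s y hs h hφy0).le.trans hge
        · exact hglob y hy s ⟨h, hst.trans htT⟩
      have h2 : φ y * (s * H s y) ≤ φ y * (t' * H t' y) := by linarith
      exact le_of_mul_le_mul_left h2 hφypos)
    (by positivity) (by rw [mul_one_div]; exact hφy.le)
    (fun z hz => by
      have h1 : (G.dist x₀ z : ℝ) ≤ G.dist x₀ y + 1 := by
        exact_mod_cast dist_le_dist_add_one hy.1 hz
      refine le_min (by linarith [hφ1 y, (by positivity : 0 ≤ 1 / R)]) ?_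
      have h2 : φ y ≤ (2 * R - G.dist x₀ y) / R := min_le_right _ _
      have h3 : (2 * R - G.dist x₀ y) / R - 1 / R ≤ (2 * R - G.dist x₀ z) / R := by
        rw [← sub_div]
        exact div_le_div_of_nonneg_right (by linarith) hR0.le
      linarith)
    (fun z hz => by
      refine le_of_mul_le_mul_left (a := t') ?_ ht0
      obtain ⟨hzS, hz0⟩ := hnbr y hy z hz
      rcases le_or_gt (φ z) (2 / R) with h | h
      · exact (hbdry t' z ht0 htT h hz0).le.trans hge
      · exact hglob z (hmem z hzS.1 h) t' ⟨htτ, htT⟩)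
    hHy (hB₂.trans hBy)
  have hDw0 := Dw_nonneg hw
  have hup : n / (2 * (1 - α)) * (φ y + t' * (2 * (1 / R) * Dw G w * M))
      ≤ n / (2 * (1 - α)) * (1 + T * (2 * (1 / R) * Dw G w * M)) :=
    mul_le_mul_of_nonneg_left
      (add_le_add (hφ1 y) (mul_le_mul_of_nonneg_right htT (by positivity))) (by positivity)
  have e : n / (2 * (1 - α)) * (1 + T * (2 * (1 / R) * Dw G w * M))
      = T * (n / ((1 - α) * (2 * T)) + n * Dw G w * M / ((1 - α) * R)) := by
    field_simp
  have hlast := hge.trans (hfinal.trans hup)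
  rw [e] at hlast
  linarith [le_of_mul_le_mul_left hlast hT]

end WGraph

/-! ### Passage to √u and the choice of B. -/

theorem corollary2 {V : Type*} (G : SimpleGraph V) [G.LocallyFinite]
    (w : V → V → ℝ) (hw : ∀ x y, G.Adj x y → 0 < w x y)
    (μ : V → ℝ) (hμ : ∀ x, 0 < μ x)
    (hDμ : BddAbove (WGraph.degMuRatios G w μ))
    (hDw : BddAbove (WGraph.degWRatios G w))
    (n K : ℝ) (hn : 0 < n) (hK : 0 < K)
    (hCDE : WGraph.CDE G w μ n (-K))
    (x₀ : V) (R : ℝ) (hR : 1 < R)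
    (u : V → ℝ → ℝ) (hu : ∀ x t, 0 < t → 0 < u x t)
    (hheat : ∀ x ∈ WGraph.openBall G x₀ (2 * R), ∀ t : ℝ, 0 < t →
      HasDerivAt (fun s => u x s) (WGraph.lap G w μ (fun y => u y t) x) t)
    (α : ℝ) (hα₀ : 0 < α) (hα₁ : α < 1) :
    ∀ x ∈ WGraph.closedBall G x₀ R, ∀ t : ℝ, 0 < t →
      (1 - α) * WGraph.Gam G w μ (fun y => √(u y t)) (fun y => √(u y t)) x / u x t
          - deriv (fun s => √(u x s)) t / √(u x t)
        ≤ min (WGraph.Dmu G w μ)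
            (n / ((1 - α) * (2 * t))
              + n * (2 + WGraph.Dw G w) * WGraph.Dmu G w μ / ((1 - α) * R)
              + K * n / (2 * α)) := by
  have hα : 0 < 1 - α := by linarith
  have hR0 : 0 < R := by linarith
  have hf : ∀ s y, 0 < s → 0 < (fun (s : ℝ) (y : V) => √(u y s)) s y := fun s y hs =>
    Real.sqrt_pos.2 (hu y s hs)
  have hd : ∀ x ∈ WGraph.openBall G x₀ (2 * R), ∀ t : ℝ, 0 < t →
      HasDerivAt (fun s => √(u x s)) (WGraph.lap G w μ (fun y => √(u y t)) x
        + WGraph.Gam G w μ (fun y => √(u y t)) (fun y => √(u y t)) x / √(u x t)) t := by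
    intro x hx t ht
    refine ((hheat x hx t ht).sqrt (hu x t ht).ne').congr_deriv ?_
    have e : (fun y => u y t) = fun y => (√(u y t)) ^ 2 :=
      funext fun y => (Real.sq_sqrt (hu y t ht).le).symm
    rw [e, WGraph.lap_sq]
    have := (hf t x ht).ne'
    simp only at this
    field_simp
  intro x hx t ht
  have hxo : x ∈ WGraph.openBall G x₀ (2 * R) := ⟨hx.1, by linarith [hx.2]⟩
  have hlhs : (1 - α) * WGraph.Gam G w μ (fun y => √(u y t)) (fun y => √(u y t)) x / u x t
      - deriv (fun s => √(u x s)) t / √(u x t)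
      = WGraph.liYau G w μ α (fun y => √(u y t)) x := by
    rw [(hd x hxo t ht).deriv, WGraph.liYau]
    have h1 := Real.sq_sqrt (hu x t ht).le
    have h2 := (hf t x ht).ne'
    simp only at h2
    have h3 : ∀ A, A / u x t = A / √(u x t) ^ 2 := fun A => by rw [h1]
    rw [h3]
    field_simp
    ring
  rw [hlhs]
  have hM := WGraph.liYau_le_Dmu hw hμ hDμ hα₀ (fun y => hf t y ht) x
  refine le_min hM ?_
  have hM0 : 0 ≤ WGraph.Dmu G w μ :=
    (div_nonneg (WGraph.deg_nonneg hw x) (hμ x).le).trans (WGraph.deg_div_le_Dmu hDμ x)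
  have hDw0 := WGraph.Dw_nonneg hw
  have p1 : 0 ≤ n / ((1 - α) * (2 * t)) := by positivity
  have p2 : 0 ≤ n * (2 + WGraph.Dw G w) * WGraph.Dmu G w μ / ((1 - α) * R) := by positivity
  have p3 : 0 ≤ K * n / (2 * α) := by positivity
  rcases hM0.eq_or_lt with h0 | h0
  · rw [← h0] at hM p2 ⊢
    linarith
  rcases lt_or_ge (n * (2 + WGraph.Dw G w)) (2 * (1 - α)) with hcase | hcase
  -- An edge is needed for D_w ≥ 1, since the supremum over no edges is 0. Then 3n ≤ 2(1-α), and the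
  -- single-peak bound gives (1+3α)/2 · D_μ ≤ nK, where (1+3α)/2 ≥ 2α.
  · have hedge : ∃ a b, G.Adj a b := by
      by_contra! hno
      have : WGraph.Dmu G w μ ≤ 0 := by
        refine csSup_le ⟨_, x, rfl⟩ ?_
        rintro r ⟨y, rfl⟩
        have : WGraph.deg G w y = 0 :=
          Finset.sum_eq_zero fun z hz => absurd ((G.mem_neighborFinset y z).1 hz) (hno y z)
        rw [this, zero_div]
      linarith
    obtain ⟨a, b, hab⟩ := hedge
    have h1 := WGraph.one_le_Dw hw hDw hab
    have h2 := WGraph.two_mul_Dmu_le hw hμ hDμ hn hK hCDE x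
    have h3 : 3 * n ≤ 2 * (1 - α) := by nlinarith
    have h4 : WGraph.Dmu G w μ ≤ K * n / (2 * α) := by
      rw [le_div_iff₀ (by positivity)]
      nlinarith [mul_le_mul_of_nonneg_right h3 h0.le]
    linarith
  · refine WGraph.liYau_le_of_heat hw hμ hDμ hDw hn hK hCDE hα₀ hα₁ hR hf hd ht ?_ ?_ ?_ hx
    · have : 2 * WGraph.Dmu G w μ / R
          ≤ n * (2 + WGraph.Dw G w) * WGraph.Dmu G w μ / ((1 - α) * R) := by
        rw [div_le_div_iff₀ hR0 (by positivity)]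
        have := mul_le_mul_of_nonneg_right hcase (by positivity : 0 ≤ WGraph.Dmu G w μ * R)
        linarith
      linarith
    · linarith
    · have : n * WGraph.Dw G w * WGraph.Dmu G w μ / ((1 - α) * R)
          ≤ n * (2 + WGraph.Dw G w) * WGraph.Dmu G w μ / ((1 - α) * R) := by
        gcongr
        linarith
      linarith
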